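/- Let $V$ be a complex Hilbert space of finite dimension, with inner product $\langle\cdot|\cdot\rangle$ antilinear in the first variable. Let $SV=\bigoplus_{d\ge 0}S^dV$ be its symmetric algebra with the canonical inner product, for which the summands $S^dV$ are mutually perpendicular, $\mathbf 1\in S^0V$ is a unit vector, and $\langle x_1\cdots x_d|y_1\cdots y_d\rangle=\sum_p\prod_{j}\langle x_j|y_{p(j)}\rangle$, where $p$ runs over the permutations of $\{1,\dots,d\}$. Let $SV'$ be the space of all antilinear functionals $SV\to\mathbb C$, in which $SV$ is embedded by $\phi\mapsto\langle\cdot|\phi\rangle$; for $\Phi\in SV'$ let $\Phi_d\in S^dV$ be the vector that represents the restriction of $\Phi$ to $S^dV$, i.e. $\Phi(\theta)=\langle\theta|\Phi_d\rangle$ for all $\theta\in S^dV$. For $\Phi,\Psi\in SV'$ and $0<t<1$ put $\langle\Phi:\Psi\rangle_t=\sum_{d\ge0}\langle\Phi_d|\Psi_d\rangle t^{2d}$ whenever the series converges, and let the extended bosonic pairing be $\langle\Phi:\Psi\rangle=\lim_{t\uparrow1}\langle\Phi:\Psi\rangle_t$ whenever this limit exists. To an antilinear map $Z:V\to V$ that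 is symmetric, i.e. $\langle y|Zx\rangle=\langle x|Zy\rangle$ for all $x,y\in V$, corresponds the unique $\zeta\in S^2V$ with $\langle y|Zx\rangle=\langle xy|\zeta\rangle$ for all $x,y\in V$, and the Gaussian $e^Z=\sum_{d\ge0}\zeta^d/d!\in SV'$. Let $\overline{\mathcal D}(V)$ be the set of symmetric antilinear maps $Z:V\to V$ of operator norm $\|Z\|\le1$. Let $\mathcal G(V)$ be the set of complex-linear maps $T:V\to V$ such that $\mathrm{Re}\langle v|Tv\rangle>0$ for all $0\ne v\in V$, and let $\mathrm{Det}^{1/2}:\mathcal G(V)\to\mathbb C$ be the holomorphic square root of the determinant with $\mathrm{Det}^{1/2}(I)=1$. Theorem. If $X,Y\in\overline{\mathcal D}(V)$ are such that $I-YX$ is invertible, then $I-YX\in\mathcal G(V)$, the extended bosonic pairing $\langle e^X:e^Y\rangle$ is defined, and $$\langle e^X:e^Y\rangle=\mathrm{Det}^{1/2}(I-YX)^{-1}.$$ -/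

import Mathlib

open scoped ComplexConjugate InnerProductSpace Topology
open Filter

namespace BosonicPairing

set_option linter.unusedSectionVars false

noncomputable section

section
variable {m : ℕ}

theorem sum_support_eq {p q : MvPolynomial (Fin m) ℂ} {s : Finset (Fin m →₀ ℕ)}
    (hs : p.support ⊆ s) :
    ∑ D ∈ p.support, ((∏ i, (D i).factorial : ℕ) : ℂ) * (conj (p.coeff D) * q.coeff D) =
      ∑ D ∈ s, ((∏ i, (D i).factorial : ℕ) : ℂ) * (conj (p.coeff D) * q.coeff D) := by
  refine Finset.sum_subset hs fun D _ hD => ?_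
  rw [MvPolynomial.notMem_support_iff.1 hD]
  simp

variable (m) in
/-- The sesquilinear form on polynomials for which distinct monomials are orthogonal and
`X₁ ^ d₁ ⋯ Xₘ ^ dₘ` has square norm `d₁! ⋯ dₘ!`. -/
def polyInner : MvPolynomial (Fin m) ℂ →ₗ⋆[ℂ] MvPolynomial (Fin m) ℂ →ₗ[ℂ] ℂ :=
  LinearMap.mk₂'ₛₗ (starRingEnd ℂ) (RingHom.id ℂ)
    (fun p q => ∑ D ∈ p.support, ((∏ i, (D i).factorial : ℕ) : ℂ) * (conj (p.coeff D) * q.coeff D))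
    (fun p p' q => by
      classical
      rw [sum_support_eq (p := p + p') MvPolynomial.support_add,
        sum_support_eq (p := p) Finset.subset_union_left,
        sum_support_eq (p := p') Finset.subset_union_right, ← Finset.sum_add_distrib]
      refine Finset.sum_congr rfl fun D _ => ?_
      rw [MvPolynomial.coeff_add, map_add]
      ring)
    (fun c p q => by
      rw [sum_support_eq (p := c • p) (s := p.support) MvPolynomial.support_smul,
        Finset.smul_sum]
      refine Finset.sum_congr rfl fun D _ => ?_
      rw [MvPolynomial.coeff_smul, smul_eq_mul, map_mul, smul_eq_mul]
      ring)
    (fun p q q' => by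
      rw [← Finset.sum_add_distrib]
      refine Finset.sum_congr rfl fun D _ => ?_
      rw [MvPolynomial.coeff_add]
      ring)
    (fun c p q => by
      rw [Finset.smul_sum]
      refine Finset.sum_congr rfl fun D _ => ?_
      rw [MvPolynomial.coeff_smul, RingHom.id_apply, smul_eq_mul, smul_eq_mul]
      ring)

theorem polyInner_apply (p q : MvPolynomial (Fin m) ℂ) :
    polyInner m p q =
      ∑ D ∈ p.support, ((∏ i, (D i).factorial : ℕ) : ℂ) * (conj (p.coeff D) * q.coeff D) := rfl

theorem polyInner_monomial_left (D : Fin m →₀ ℕ) (a : ℂ) (q : MvPolynomial (Fin m) ℂ) :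
    polyInner m (MvPolynomial.monomial D a) q =
      ((∏ i, (D i).factorial : ℕ) : ℂ) * (conj a * q.coeff D) := by
  classical
  rw [polyInner_apply, sum_support_eq (s := {D}) MvPolynomial.support_monomial_subset]
  simp

theorem polyInner_monomial_right (D : Fin m →₀ ℕ) (a : ℂ) (p : MvPolynomial (Fin m) ℂ) :
    polyInner m p (MvPolynomial.monomial D a) =
      ((∏ i, (D i).factorial : ℕ) : ℂ) * (conj (p.coeff D) * a) := by
  classical
  rw [polyInner_apply, sum_support_eq (s := p.support ∪ {D}) Finset.subset_union_left,
    Finset.sum_eq_single D]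
  · simp
  · intro D' _ h
    simp [MvPolynomial.coeff_monomial, h.symm]
  · simp

theorem polyInner_X_mul (i : Fin m) (p q : MvPolynomial (Fin m) ℂ) :
    polyInner m (MvPolynomial.X i * p) q = polyInner m p (MvPolynomial.pderiv i q) := by
  induction p using MvPolynomial.induction_on' with
  | add p p' hp hp' => rw [mul_add, map_add, map_add, LinearMap.add_apply, hp, hp',
      LinearMap.add_apply]
  | monomial D a =>
    rw [MvPolynomial.X, MvPolynomial.monomial_mul, polyInner_monomial_left,
      polyInner_monomial_left, MvPolynomial.coeff_pderiv, one_mul, add_comm (Finsupp.single i 1) D]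
    have h : (∏ j, ((D + Finsupp.single i 1 : Fin m →₀ ℕ) j).factorial) = (D i + 1) * ∏ j, (D j).factorial := by
      rw [← Finset.mul_prod_erase _ _ (Finset.mem_univ i),
        ← Finset.mul_prod_erase Finset.univ (fun j => (D j).factorial) (Finset.mem_univ i), ← mul_assoc]
      congr 1
      · simp [Nat.factorial_succ]
      · refine Finset.prod_congr rfl fun j hj => ?_
        simp [(Finset.ne_of_mem_erase hj).symm]
    rw [h]
    push_cast
    ring

theorem polyInner_conj_symm (p q : MvPolynomial (Fin m) ℂ) :
    conj (polyInner m q p) = polyInner m p q := by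
  classical
  rw [polyInner_apply, polyInner_apply, sum_support_eq (s := p.support ∪ q.support)
    Finset.subset_union_left, sum_support_eq (s := p.support ∪ q.support)
    Finset.subset_union_right, map_sum]
  refine Finset.sum_congr rfl fun D _ => ?_
  simp only [map_mul, Complex.conj_natCast, Complex.conj_conj]
  ring

theorem polyInner_self (p : MvPolynomial (Fin m) ℂ) :
    polyInner m p p =
      ((∑ D ∈ p.support, ((∏ i, (D i).factorial : ℕ) : ℝ) * ‖p.coeff D‖ ^ 2 : ℝ) : ℂ) := by
  rw [polyInner_apply]
  push_cast
  refine Finset.sum_congr rfl fun D _ => ?_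
  rw [Complex.conj_mul']

theorem polyInner_self_pos {p : MvPolynomial (Fin m) ℂ} (hp : p ≠ 0) :
    0 < (polyInner m p p).re := by
  rw [polyInner_self, Complex.ofReal_re]
  refine Finset.sum_pos (fun D hD => ?_) (MvPolynomial.support_nonempty.2 hp)
  have h1 : 0 < ‖p.coeff D‖ := norm_pos_iff.2 (MvPolynomial.mem_support_iff.1 hD)
  have h2 : 0 < ∏ i, (D i).factorial := Finset.prod_pos fun i _ => Nat.factorial_pos _
  positivity

theorem polyInner_eq_zero_of_isHomogeneous {p q : MvPolynomial (Fin m) ℂ} {k : ℕ}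
    (hq : q.IsHomogeneous k) (hp : ∀ D ∈ p.support, D.degree ≠ k) :
    polyInner m p q = 0 := by
  rw [polyInner_apply]
  refine Finset.sum_eq_zero fun D hD => ?_
  rw [hq.coeff_eq_zero (hp D hD)]
  simp

end

section
variable (V : Type*) [NormedAddCommGroup V] [InnerProductSpace ℂ V] [FiniteDimensional ℂ V]

/-- The coordinates `SV ≃ ℂ[X₁, …, Xₘ]` given by a unitary basis of `V`. -/
def coord : SymmetricAlgebra ℂ V ≃ₐ[ℂ] MvPolynomial (Fin (Module.finrank ℂ V)) ℂ :=
  SymmetricAlgebra.equivMvPolynomial (stdOrthonormalBasis ℂ V).toBasis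

/-- The canonical inner product on `SV`, antilinear in its first argument. -/
def symInner : SymmetricAlgebra ℂ V →ₗ⋆[ℂ] SymmetricAlgebra ℂ V →ₗ[ℂ] ℂ :=
  LinearMap.mk₂'ₛₗ (starRingEnd ℂ) (RingHom.id ℂ)
    (fun φ ψ => polyInner _ (coord V φ) (coord V ψ))
    (by simp) (by simp) (by simp) (by simp)

/-- The homogeneous summand `S^d V` of the symmetric algebra. -/
def symPow (d : ℕ) : Submodule ℂ (SymmetricAlgebra ℂ V) :=
  LinearMap.range (SymmetricAlgebra.ι ℂ V) ^ d

variable {V}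

theorem symInner_apply (φ ψ : SymmetricAlgebra ℂ V) :
    symInner V φ ψ = polyInner _ (coord V φ) (coord V ψ) := rfl

theorem coord_ι (x : V) : coord V (SymmetricAlgebra.ι ℂ V x) =
    ∑ i, ⟪stdOrthonormalBasis ℂ V i, x⟫_ℂ • MvPolynomial.X i := by
  conv_lhs => rw [← (stdOrthonormalBasis ℂ V).sum_repr' x]
  simp only [map_sum, map_smul]
  refine Finset.sum_congr rfl fun i _ => ?_
  have := SymmetricAlgebra.equivMvPolynomial_ι_apply (stdOrthonormalBasis ℂ V).toBasis i
  rw [OrthonormalBasis.coe_toBasis] at this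
  rw [coord, this]

theorem symInner_conj_symm (φ ψ : SymmetricAlgebra ℂ V) :
    conj (symInner V ψ φ) = symInner V φ ψ := polyInner_conj_symm _ _

theorem symInner_self_pos {φ : SymmetricAlgebra ℂ V} (hφ : φ ≠ 0) :
    0 < (symInner V φ φ).re :=
  polyInner_self_pos (by simpa using hφ)

theorem symInner_one : symInner V 1 1 = 1 := by
  rw [symInner_apply, map_one, ← MvPolynomial.C_1, MvPolynomial.C_apply, polyInner_monomial_left]
  simp

/-- The annihilation derivation of a vector, in coordinates. -/
def annih (x : V) : Derivation ℂ (MvPolynomial (Fin (Module.finrank ℂ V)) ℂ)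
    (MvPolynomial (Fin (Module.finrank ℂ V)) ℂ) :=
  ∑ i, ⟪x, stdOrthonormalBasis ℂ V i⟫_ℂ • MvPolynomial.pderiv i

theorem annih_apply (x : V) (p : MvPolynomial (Fin (Module.finrank ℂ V)) ℂ) :
    annih x p = ∑ i, ⟪x, stdOrthonormalBasis ℂ V i⟫_ℂ • MvPolynomial.pderiv i p := by
  have h := map_sum (Derivation.coeFnAddMonoidHom (R := ℂ)
    (A := MvPolynomial (Fin (Module.finrank ℂ V)) ℂ)
    (M := MvPolynomial (Fin (Module.finrank ℂ V)) ℂ))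
    (fun i => ⟪x, stdOrthonormalBasis ℂ V i⟫_ℂ • MvPolynomial.pderiv i) Finset.univ
  have h2 := congrFun h p
  rw [Finset.sum_apply] at h2
  exact h2

theorem symInner_ι_mul (x : V) (φ ψ : SymmetricAlgebra ℂ V) :
    symInner V (SymmetricAlgebra.ι ℂ V x * φ) ψ =
      polyInner _ (coord V φ) (annih x (coord V ψ)) := by
  rw [symInner_apply, map_mul, coord_ι, Finset.sum_mul, map_sum, annih_apply]
  simp only [map_sum, LinearMap.sum_apply, smul_mul_assoc,
    map_smul, LinearMap.map_smulₛₗ, LinearMap.smul_apply, polyInner_X_mul,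
    inner_conj_symm]

theorem annih_ι (x y : V) : annih x (coord V (SymmetricAlgebra.ι ℂ V y)) =
    algebraMap ℂ _ ⟪x, y⟫_ℂ := by
  classical
  rw [coord_ι, annih_apply]
  simp only [map_sum, Derivation.map_smul, MvPolynomial.pderiv_X, Pi.single_apply, smul_ite,
    smul_zero, Finset.sum_ite_eq', Finset.mem_univ, if_true]
  rw [← OrthonormalBasis.sum_inner_mul_inner (stdOrthonormalBasis ℂ V) x y, map_sum]
  simp [Algebra.smul_def]

theorem annih_prod (x : V) (n : ℕ) (z : Fin n → V) :
    annih x (∏ j, coord V (SymmetricAlgebra.ι ℂ V (z j))) =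
    ∑ k, ⟪x, z k⟫_ℂ •
      ∏ j ∈ Finset.univ.erase k, coord V (SymmetricAlgebra.ι ℂ V (z j)) := by
  generalize (Finset.univ : Finset (Fin n)) = s
  induction s using Finset.induction_on with
  | empty => simp
  | insert a s ha ih =>
    rw [Finset.prod_insert ha, Derivation.leibniz, ih, annih_ι, Finset.sum_insert ha,
      Finset.erase_insert ha, add_comm, Finset.smul_sum]
    congr 1
    · rw [smul_eq_mul, mul_comm, Algebra.smul_def]
    · refine Finset.sum_congr rfl fun k hk => ?_
      have hka : a ≠ k := fun h => ha (h ▸ hk)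
      rw [Finset.erase_insert_of_ne hka, Finset.prod_insert (by simp [ha]), smul_eq_mul,
        mul_smul_comm]

/-- The characteristic property of the inner product of the symmetric algebra. -/
theorem symInner_prod : ∀ (d : ℕ) (x y : Fin d → V),
    symInner V (∏ j, SymmetricAlgebra.ι ℂ V (x j)) (∏ j, SymmetricAlgebra.ι ℂ V (y j)) =
      ∑ p : Equiv.Perm (Fin d), ∏ j, ⟪x j, y (p j)⟫_ℂ
  | 0, x, y => by simp [symInner_one]
  | d + 1, x, y => by
    rw [Fin.prod_univ_succ, symInner_ι_mul, map_prod (coord V) (fun j => SymmetricAlgebra.ι ℂ V (y j)), annih_prod,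
      map_sum,
      ← Equiv.Perm.decomposeFin.symm.sum_comp, Fintype.sum_prod_type]
    refine Finset.sum_congr rfl fun k _ => ?_
    have h : ∏ j ∈ Finset.univ.erase k, coord V (SymmetricAlgebra.ι ℂ V (y j)) =
        coord V (∏ j : Fin d, SymmetricAlgebra.ι ℂ V (y (Equiv.swap 0 k j.succ))) := by
      rw [map_prod]
      refine Eq.trans ?_ (Finset.prod_map Finset.univ
        ((Fin.succEmb d).trans (Equiv.swap 0 k).toEmbedding)
        (fun j => coord V (SymmetricAlgebra.ι ℂ V (y j))))
      refine Finset.prod_congr ?_ fun _ _ => rfl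
      ext j
      simp only [Finset.mem_erase, Finset.mem_univ, and_true, Finset.mem_map, true_and]
      constructor
      · intro hj
        have h0 : Equiv.swap 0 k j ≠ 0 := fun h => hj (by
          rw [Equiv.swap_apply_eq_iff, Equiv.swap_apply_left] at h; exact h)
        obtain ⟨i, hi⟩ := Fin.exists_succ_eq.2 h0
        exact ⟨i, by simp [hi]⟩
      · rintro ⟨i, rfl⟩ h
        have : i.succ = 0 := by
          simpa [Equiv.swap_apply_eq_iff] using h
        exact Fin.succ_ne_zero _ this
    rw [map_smul, h, ← symInner_apply, symInner_prod d, smul_eq_mul, Finset.mul_sum]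
    refine Finset.sum_congr rfl fun e _ => ?_
    rw [Fin.prod_univ_succ]
    simp [Equiv.Perm.decomposeFin_symm_apply_zero, Equiv.Perm.decomposeFin_symm_apply_succ]

theorem mem_symPow_iff {d : ℕ} {φ : SymmetricAlgebra ℂ V} :
    φ ∈ symPow V d ↔ (coord V φ).IsHomogeneous d := by
  have h1 : (LinearMap.range (SymmetricAlgebra.ι ℂ V)).map (coord V).toAlgHom.toLinearMap =
      MvPolynomial.homogeneousSubmodule (Fin (Module.finrank ℂ V)) ℂ 1 := by
    rw [MvPolynomial.homogeneousSubmodule_one_eq_span_X]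
    apply le_antisymm
    · rintro _ ⟨_, ⟨x, rfl⟩, rfl⟩
      change coord V _ ∈ _
      rw [coord_ι]
      exact Submodule.sum_mem _ fun i _ => Submodule.smul_mem _ _
        (Submodule.subset_span ⟨i, rfl⟩)
    · rw [Submodule.span_le]
      rintro _ ⟨i, rfl⟩
      refine ⟨_, ⟨stdOrthonormalBasis ℂ V i, rfl⟩, ?_⟩
      have := SymmetricAlgebra.equivMvPolynomial_ι_apply (stdOrthonormalBasis ℂ V).toBasis i
      rw [OrthonormalBasis.coe_toBasis] at this
      exact this
  have h2 : (symPow V d).map (coord V).toAlgHom.toLinearMap =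
      MvPolynomial.homogeneousSubmodule (Fin (Module.finrank ℂ V)) ℂ d := by
    rw [symPow, Submodule.map_pow, h1, MvPolynomial.homogeneousSubmodule_one_pow]
  rw [← MvPolynomial.mem_homogeneousSubmodule, ← h2]
  constructor
  · exact fun h => ⟨φ, h, rfl⟩
  · rintro ⟨ψ, h, e⟩
    have : ψ = φ := (coord V).injective e
    exact this ▸ h

/-- Distinct homogeneous summands are perpendicular. -/
theorem symInner_of_mem_symPow {c d : ℕ} (h : c ≠ d) {φ ψ : SymmetricAlgebra ℂ V}
    (hφ : φ ∈ symPow V c) (hψ : ψ ∈ symPow V d) : symInner V φ ψ = 0 := by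
  rw [mem_symPow_iff] at hφ hψ
  refine polyInner_eq_zero_of_isHomogeneous hψ fun D hD hDd => h ?_
  rw [← hDd]
  by_contra hne
  exact MvPolynomial.mem_support_iff.1 hD (hφ.coeff_eq_zero (Ne.symm hne))

variable (V) in
/-- The full antidual `SV'`: all antilinear functionals on the symmetric algebra. -/
abbrev Antidual : Type _ := SymmetricAlgebra ℂ V →ₗ⋆[ℂ] ℂ

/-- The homogeneous component `Φ_d`, the restriction of `Φ` to `S^d V`, as an
element of `S^d V` (see `component_mem` and `component_spec`): the sum of `Φ(v^D) v^D` over the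
unitary basis vectors `v^D` of `S^d V`. -/
def component (Φ : Antidual V) (d : ℕ) : SymmetricAlgebra ℂ V :=
  ∑ D ∈ Finset.finsuppAntidiag Finset.univ d,
    (Φ ((coord V).symm (MvPolynomial.monomial D 1)) / ((∏ i, (D i).factorial : ℕ) : ℂ)) •
      (coord V).symm (MvPolynomial.monomial D 1)

theorem mem_finsuppAntidiag_univ {m d : ℕ} {D : Fin m →₀ ℕ} :
    D ∈ Finset.finsuppAntidiag Finset.univ d ↔ D.degree = d := by
  simp [Finset.mem_finsuppAntidiag, Finsupp.degree_eq_sum]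

theorem component_mem (Φ : Antidual V) (d : ℕ) : component Φ d ∈ symPow V d := by
  refine Submodule.sum_mem _ fun D hD => Submodule.smul_mem _ _ (mem_symPow_iff.2 ?_)
  rw [AlgEquiv.apply_symm_apply]
  exact MvPolynomial.isHomogeneous_monomial _ (mem_finsuppAntidiag_univ.1 hD)

theorem component_spec (Φ : Antidual V) {d : ℕ} {θ : SymmetricAlgebra ℂ V}
    (hθ : θ ∈ symPow V d) : Φ θ = symInner V θ (component Φ d) := by
  rw [mem_symPow_iff] at hθ
  have h : θ = ∑ D ∈ Finset.finsuppAntidiag Finset.univ d,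
      (coord V θ).coeff D • (coord V).symm (MvPolynomial.monomial D 1) := by
    apply (coord V).injective
    simp only [map_sum, map_smul, AlgEquiv.apply_symm_apply]
    conv_lhs => rw [MvPolynomial.as_sum (coord V θ)]
    have hsub : (coord V θ).support ⊆ Finset.finsuppAntidiag Finset.univ d := fun D hD => by
      rw [mem_finsuppAntidiag_univ]
      by_contra hne
      exact MvPolynomial.mem_support_iff.1 hD (hθ.coeff_eq_zero hne)
    rw [Finset.sum_subset hsub]
    · simp [MvPolynomial.smul_monomial]
    · intro D _ hD
      simp [MvPolynomial.notMem_support_iff.1 hD]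
  conv_lhs => rw [h]
  rw [component, map_sum, map_sum]
  refine Finset.sum_congr rfl fun D _ => ?_
  have hD : ((∏ i, (D i).factorial : ℕ) : ℂ) ≠ 0 :=
    Nat.cast_ne_zero.2 (Finset.prod_ne_zero_iff.2 fun i _ => Nat.factorial_ne_zero _)
  rw [LinearMap.map_smulₛₗ, map_smul, symInner_apply, AlgEquiv.apply_symm_apply,
    polyInner_monomial_right, smul_eq_mul, smul_eq_mul]
  field_simp

/-- Antilinear maps with the symmetry `⟨y | Z x⟩ = ⟨x | Z y⟩`. -/
def IsSymmetric (Z : V →L⋆[ℂ] V) : Prop := ∀ x y : V, ⟪y, Z x⟫_ℂ = ⟪x, Z y⟫_ℂ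

/-- The quadratic in `S² V` corresponding to a symmetric antilinear map (see `quadratic_spec`). -/
def quadratic (Z : V →L⋆[ℂ] V) : SymmetricAlgebra ℂ V :=
  (1 / 2 : ℂ) • ∑ k, SymmetricAlgebra.ι ℂ V (stdOrthonormalBasis ℂ V k) *
    SymmetricAlgebra.ι ℂ V (Z (stdOrthonormalBasis ℂ V k))

theorem quadratic_mem (Z : V →L⋆[ℂ] V) : quadratic Z ∈ symPow V 2 := by
  refine Submodule.smul_mem _ _ (Submodule.sum_mem _ fun k _ => ?_)
  rw [symPow, pow_two]
  exact Submodule.mul_mem_mul ⟨_, rfl⟩ ⟨_, rfl⟩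

theorem symInner_mul_mul (x y u v : V) :
    symInner V (SymmetricAlgebra.ι ℂ V x * SymmetricAlgebra.ι ℂ V y)
      (SymmetricAlgebra.ι ℂ V u * SymmetricAlgebra.ι ℂ V v) =
      ⟪x, u⟫_ℂ * ⟪y, v⟫_ℂ + ⟪x, v⟫_ℂ * ⟪y, u⟫_ℂ := by
  have := symInner_prod 2 ![x, y] ![u, v]
  simp only [Fin.prod_univ_two, Matrix.cons_val_zero, Matrix.cons_val_one] at this
  rw [this, ← Equiv.Perm.decomposeFin.symm.sum_comp, Fintype.sum_prod_type]
  simp [Fin.sum_univ_two, Equiv.Perm.decomposeFin_symm_apply_one]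

theorem quadratic_spec {Z : V →L⋆[ℂ] V} (hZ : IsSymmetric Z) (x y : V) :
    ⟪y, Z x⟫_ℂ =
      symInner V (SymmetricAlgebra.ι ℂ V x * SymmetricAlgebra.ι ℂ V y) (quadratic Z) := by
  have key : ∀ x y : V, ∑ k, ⟪x, stdOrthonormalBasis ℂ V k⟫_ℂ *
      ⟪y, Z (stdOrthonormalBasis ℂ V k)⟫_ℂ = ⟪y, Z x⟫_ℂ := by
    intro x y
    conv_rhs => rw [← (stdOrthonormalBasis ℂ V).sum_repr' x]
    simp only [map_sum, map_smulₛₗ, inner_sum, inner_smul_right, inner_conj_symm]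
  have hq := key y x
  simp only [quadratic, map_smul, map_sum, symInner_mul_mul, Finset.sum_add_distrib, key,
    smul_eq_mul]
  rw [Finset.sum_congr rfl fun k _ => mul_comm _ _, hq, ← hZ x y]
  ring

theorem quadratic_unique {Z : V →L⋆[ℂ] V} (hZ : IsSymmetric Z) {ζ : SymmetricAlgebra ℂ V}
    (hζ : ζ ∈ symPow V 2) (h : ∀ x y : V, ⟪y, Z x⟫_ℂ =
      symInner V (SymmetricAlgebra.ι ℂ V x * SymmetricAlgebra.ι ℂ V y) ζ) : ζ = quadratic Z := by
  by_contra hne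
  have h0 : ζ - quadratic Z ≠ 0 := sub_ne_zero.2 hne
  have hmem : ζ - quadratic Z ∈ symPow V 2 := Submodule.sub_mem _ hζ (quadratic_mem Z)
  have hz : ∀ θ ∈ symPow V 2, symInner V θ (ζ - quadratic Z) = 0 := by
    intro θ hθ
    rw [symPow, pow_two] at hθ
    induction hθ using Submodule.mul_induction_on' with
    | mem_mul_mem a ha b hb =>
      obtain ⟨x, rfl⟩ := ha
      obtain ⟨y, rfl⟩ := hb
      rw [map_sub, ← h, ← quadratic_spec hZ, sub_self]
    | add a _ b _ ha hb => rw [map_add, LinearMap.add_apply, ha, hb, add_zero]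
  have := symInner_self_pos h0
  rw [hz _ hmem] at this
  simp at this

theorem finite_support_pairing {ζ : SymmetricAlgebra ℂ V} (hζ : ζ ∈ symPow V 2)
    (θ : SymmetricAlgebra ℂ V) :
    (Function.support fun d : ℕ => symInner V θ ((d.factorial : ℂ)⁻¹ • ζ ^ d)).Finite := by
  refine (Set.finite_Iic (coord V θ).totalDegree).subset fun d hd => ?_
  by_contra hlt
  refine hd ?_
  have hlt : (coord V θ).totalDegree < d := not_le.1 hlt
  have hh : (coord V ((d.factorial : ℂ)⁻¹ • ζ ^ d)).IsHomogeneous (2 * d) := by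
    rw [← mem_symPow_iff]
    refine Submodule.smul_mem _ _ ?_
    have := Submodule.pow_mem_pow _ hζ d
    rwa [symPow, ← pow_mul] at this
  refine polyInner_eq_zero_of_isHomogeneous hh fun D hD => ?_
  have := MvPolynomial.le_totalDegree hD
  have h2 : D.degree = D.sum fun _ e => e := rfl
  omega

/-- The Gaussian `e^Z = ∑ ζ^d / d!` in `SV'`, each `ζ^d / d!` in `SV` being viewed as the
antifunctional `⟨· | ζ^d / d!⟩`; on every element of `SV` the sum is finite. -/
def gaussian (Z : V →L⋆[ℂ] V) : Antidual V where
  toFun θ := ∑ᶠ d : ℕ, symInner V θ ((d.factorial : ℂ)⁻¹ • quadratic Z ^ d)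
  map_add' θ θ' := by
    simp only [map_add, LinearMap.add_apply]
    exact finsum_add_distrib (finite_support_pairing (quadratic_mem Z) θ)
      (finite_support_pairing (quadratic_mem Z) θ')
  map_smul' c θ := by
    simp only [map_smulₛₗ (symInner V) c θ, LinearMap.smul_apply]
    exact (smul_finsum' (starRingEnd ℂ c) (finite_support_pairing (quadratic_mem Z) θ)).symm

/-- `⟨Φ : Ψ⟩_t` is defined and equal to `c`: the series `∑ ⟨Φ_d | Ψ_d⟩ t^{2d}` converges to `c`. -/
def HasPairingAt (t : ℝ) (Φ Ψ : Antidual V) (c : ℂ) : Prop :=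
  Tendsto (fun n : ℕ => ∑ d ∈ Finset.range n,
    symInner V (component Φ d) (component Ψ d) * (t : ℂ) ^ (2 * d)) atTop (𝓝 c)

/-- The extended bosonic pairing `⟨Φ : Ψ⟩` is defined and equal to `c`. -/
def HasPairing (Φ Ψ : Antidual V) (c : ℂ) : Prop :=
  ∃ f : ℝ → ℂ, (∀ t ∈ Set.Ioo (0 : ℝ) 1, HasPairingAt t Φ Ψ (f t)) ∧
    Tendsto f (𝓝[<] 1) (𝓝 c)

variable (V) in
/-- The closed Siegel domain. -/
def closedSiegel : Set (V →L⋆[ℂ] V) := {Z | IsSymmetric Z ∧ ‖Z‖ ≤ 1}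
end

section
variable (V : Type*) [NormedAddCommGroup V] [InnerProductSpace ℂ V] [FiniteDimensional ℂ V]

/-- The set of linear maps `T` with `Re ⟨v | T v⟩ > 0` for all `v ≠ 0`. -/
def posRe : Set (V →L[ℂ] V) := {T | ∀ v : V, v ≠ 0 → 0 < (⟪v, T v⟫_ℂ).re}

/-- `r` is on `posRe V` a holomorphic square root of the determinant, normalized by `r(I) = 1`
(see `exists_isDetSqrt` and `IsDetSqrt.eqOn` for existence and uniqueness). -/
structure IsDetSqrt (r : (V →L[ℂ] V) → ℂ) : Prop where
  differentiableOn : DifferentiableOn ℂ r (posRe V)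
  sq_eq : ∀ T ∈ posRe V, r T ^ 2 = T.det
  map_one : r 1 = 1

variable {V}

theorem one_mem_posRe : (1 : V →L[ℂ] V) ∈ posRe V := fun v hv => by
  have h : 0 < ‖v‖ := norm_pos_iff.2 hv
  rw [one_apply_eq_self, inner_self_eq_norm_sq_to_K (𝕜 := ℂ) v]
  have : (((‖v‖ : ℂ) ^ 2)).re = ‖v‖ ^ 2 := by norm_cast
  exact this ▸ by positivity

theorem convex_posRe : Convex ℝ (posRe V) := fun S hS T hT a b ha hb hab v hv => by
  have h1 := hS v hv
  have h2 := hT v hv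
  simp only [add_apply, smul_apply, inner_add_right,
    inner_smul_right_eq_smul, Complex.add_re, Complex.real_smul, Complex.re_ofReal_mul]
  rcases ha.eq_or_lt with rfl | ha
  · have : b = 1 := by linarith
    subst this; simpa using h2
  · have := mul_pos ha h1
    have := mul_nonneg hb h2.le
    linarith

theorem isOpen_posRe : IsOpen (posRe V) := by
  have : posRe V = {T | ∀ v ∈ Metric.sphere (0 : V) 1, 0 < (⟪v, T v⟫_ℂ).re} := by
    ext T
    refine ⟨fun h v hv => h v ?_, fun h v hv => ?_⟩
    · rintro rfl; simp at hv
    · have h1 := h ((‖v‖⁻¹ : ℝ) • v) (by simp [norm_smul, hv])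
      have hT : T ((‖v‖⁻¹ : ℝ) • v) = (‖v‖⁻¹ : ℝ) • T v := map_real_smul T.toAddMonoidHom T.continuous _ _
      rw [hT] at h1
      simp only [inner_smul_left_eq_smul, inner_smul_right_eq_smul, Complex.real_smul,
        Complex.re_ofReal_mul] at h1
      have h2 : 0 < ‖v‖⁻¹ := by positivity
      exact pos_of_mul_pos_right (pos_of_mul_pos_right h1 h2.le) h2.le
  rw [this, isOpen_iff_mem_nhds]
  intro T hT
  refine (isCompact_sphere (0 : V) 1).eventually_forall_of_forall_eventually fun v hv => ?_
  have hc : Continuous fun p : (V →L[ℂ] V) × V => (⟪p.2, p.1 p.2⟫_ℂ).re := by fun_prop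
  exact hc.continuousAt.eventually (lt_mem_nhds (hT v hv))

theorem det_ne_zero_of_mem_posRe {T : V →L[ℂ] V} (hT : T ∈ posRe V) : T.det ≠ 0 := by
  intro h
  have := LinearMap.bot_lt_ker_of_det_eq_zero (f := (T : V →ₗ[ℂ] V)) h
  obtain ⟨v, hv, hv0⟩ := (Submodule.ne_bot_iff _).1 this.ne'
  have h1 := hT v hv0
  have h2 : T v = 0 := hv
  simp [h2] at h1

theorem contDiff_det : ContDiff ℂ 2 (fun T : V →L[ℂ] V => T.det) := by
  let b := Module.finBasis ℂ V
  have h : (fun T : V →L[ℂ] V => T.det) = fun T => ∑ σ : Equiv.Perm (Fin (Module.finrank ℂ V)),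
      ((Equiv.Perm.sign σ : ℤ) : ℂ) * ∏ i, b.repr (T (b i)) (σ i) := by
    funext T
    rw [ContinuousLinearMap.det, ← LinearMap.det_toMatrix b, Matrix.det_apply']
    simp [LinearMap.toMatrix_apply]
  rw [h]
  refine ContDiff.sum fun σ _ => contDiff_const.mul (contDiff_prod fun i _ => ?_)
  let l : V →ₗ[ℂ] ℂ := b.coord (σ i)
  have : ContDiff ℂ 2 fun T : V →L[ℂ] V => l.toContinuousLinearMap (T (b i)) := by fun_prop
  exact this

theorem exists_isDetSqrt : ∃ r, IsDetSqrt V r := by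
  let ω : (V →L[ℂ] V) → (V →L[ℂ] V) →L[ℂ] ℂ := fun T => (T.det)⁻¹ • fderiv ℂ (fun S : V →L[ℂ] V => S.det) T
  have key : ∀ T ∈ posRe V, ∃ dω : (V →L[ℂ] V) →L[ℂ] (V →L[ℂ] V) →L[ℂ] ℂ, HasFDerivAt ω dω T ∧ ∀ x y, dω x y = dω y x := by
    intro T hT
    have h0 := det_ne_zero_of_mem_posRe hT
    let g : (V →L[ℂ] V) → ℂ := fun S => Complex.log (S.det / T.det)
    have hg : ContDiffAt ℂ 2 g T := by
      exact (Complex.contDiffAt_log (by simp [div_self h0])).comp T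
        (contDiff_det.contDiffAt.div_const _)
    have hev : fderiv ℂ g =ᶠ[𝓝 T] ω := by
      have hc : ContinuousAt (fun S : V →L[ℂ] V => S.det / T.det) T :=
        (contDiff_det.continuous.div_const _).continuousAt
      have : ∀ᶠ S in 𝓝 T, S.det / T.det ∈ Complex.slitPlane :=
        hc.eventually (Complex.isOpen_slitPlane.mem_nhds (by simp [div_self h0]))
      filter_upwards [this] with S hS
      have hd : HasFDerivAt (fun S : V →L[ℂ] V => S.det / T.det)
          ((T.det)⁻¹ • fderiv ℂ (fun S : V →L[ℂ] V => S.det) S) S := by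
        have := ((contDiff_det (V := V)).differentiable (by simp) S).hasFDerivAt.const_mul (T.det)⁻¹
        simpa [div_eq_inv_mul] using this
      have h3 := (hd.clog hS).fderiv
      refine h3.trans ?_
      have : (S.det / T.det)⁻¹ * (T.det)⁻¹ = (S.det)⁻¹ := by field_simp
      rw [smul_smul, this]
    have hs : IsSymmSndFDerivAt ℂ g T := hg.isSymmSndFDerivAt (by simp)
    refine ⟨fderiv ℂ (fderiv ℂ g) T, ?_, fun x y => hs x y⟩
    have : DifferentiableAt ℂ (fderiv ℂ g) T :=
      (hg.fderiv_right (m := 1) (by norm_num)).differentiableAt (by simp)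
    exact this.hasFDerivAt.congr_of_eventuallyEq hev.symm
  choose! dω hdω hsym using key
  obtain ⟨f, hf⟩ := (convex_posRe (V := V)).exists_forall_hasFDerivWithinAt_of_hasFDerivWithinAt_symmetric
    (ω := ω) (dω := fun T => (dω T).restrictScalars ℝ)
    (fun T hT => ((hdω T hT).restrictScalars ℝ).hasFDerivWithinAt)
    (fun T hT x _ y _ => hsym T hT x y)
  have hdet : ∀ T ∈ posRe V, HasFDerivWithinAt (fun S : V →L[ℂ] V => S.det) (T.det • ω T) (posRe V) T := by
    intro T hT
    have := ((contDiff_det (V := V)).differentiable (by simp) T).hasFDerivAt.hasFDerivWithinAt (s := posRe V)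
    simpa [ω, smul_smul, mul_inv_cancel₀ (det_ne_zero_of_mem_posRe hT)] using this
  have hE : ∀ T ∈ posRe V, HasFDerivWithinAt (fun S : V →L[ℂ] V => Complex.exp (-(f S)) * S.det)
      (0 : (V →L[ℂ] V) →L[ℂ] ℂ) (posRe V) T := by
    intro T hT
    have := ((hf T hT).fun_neg.cexp).mul (hdet T hT)
    refine this.congr_fderiv ?_
    ext x
    simp; ring
  have hone := one_mem_posRe (V := V)
  have hconst : ∀ T ∈ posRe V, Complex.exp (-(f T)) * T.det = Complex.exp (-(f 1)) := by
    intro T hT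
    have := (convex_posRe (V := V)).is_const_of_fderivWithin_eq_zero (𝕜 := ℂ)
      (fun S hS => (hE S hS).differentiableWithinAt)
      (fun S hS => (hE S hS).fderivWithin (isOpen_posRe.uniqueDiffWithinAt hS)) hT hone
    simpa [ContinuousLinearMap.det] using this
  refine ⟨fun T => Complex.exp ((f T - f 1) * (1 / 2)), ?_, ?_, by simp⟩
  · intro T hT
    exact (((hf T hT).differentiableWithinAt.sub_const (f 1)).mul_const (1 / 2)).cexp
  · intro T hT
    have := hconst T hT
    rw [← Complex.exp_nat_mul]
    have h2 : ((2:ℕ):ℂ) * ((f T - f 1) * (1 / 2)) = f T + -(f 1) := by push_cast; ring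
    rw [h2, Complex.exp_add, ← this, ← mul_assoc, ← Complex.exp_add]
    simp

theorem IsDetSqrt.eqOn {r s : (V →L[ℂ] V) → ℂ} (hr : IsDetSqrt V r) (hs : IsDetSqrt V s) :
    Set.EqOn r s (posRe V) := by
  refine (convex_posRe (V := V)).isPreconnected.eq_of_sq_eq hr.differentiableOn.continuousOn
    hs.differentiableOn.continuousOn (fun T hT => ?_) (fun {T} hT h => ?_) one_mem_posRe
    (hr.map_one.trans hs.map_one.symm)
  · simp [hr.sq_eq T hT, hs.sq_eq T hT]
  · have := hs.sq_eq T hT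
    rw [h] at this
    exact det_ne_zero_of_mem_posRe hT (by simpa using this.symm)

variable (V) in
/-- The holomorphic square root `Det^{1/2}` on `posRe V` with `Det^{1/2}(I) = 1`. -/
def detSqrt : (V →L[ℂ] V) → ℂ := Classical.choose (exists_isDetSqrt (V := V))

theorem isDetSqrt_detSqrt : IsDetSqrt V (detSqrt V) := Classical.choose_spec exists_isDetSqrt
end

end

end BosonicPairing

namespace BosonicPairing

noncomputable section GaussianRecursion

variable {V : Type*} [NormedAddCommGroup V] [InnerProductSpace ℂ V] [FiniteDimensional ℂ V]

/-- The term `ζ ^ n / n!` of the Gaussian `e^Z`. -/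
def gaussianTerm (Z : V →L⋆[ℂ] V) (n : ℕ) : SymmetricAlgebra ℂ V :=
  (n.factorial : ℂ)⁻¹ • quadratic Z ^ n

theorem gaussianTerm_zero (Z : V →L⋆[ℂ] V) : gaussianTerm Z 0 = 1 := by
  simp [gaussianTerm]

theorem gaussianTerm_mem (Z : V →L⋆[ℂ] V) (n : ℕ) : gaussianTerm Z n ∈ symPow V (2 * n) := by
  refine Submodule.smul_mem _ _ ?_
  have := Submodule.pow_mem_pow _ (quadratic_mem Z) n
  rwa [symPow, ← pow_mul] at this

theorem succ_smul_gaussianTerm_succ (Z : V →L⋆[ℂ] V) (n : ℕ) :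
    ((n : ℂ) + 1) • gaussianTerm Z (n + 1) = quadratic Z * gaussianTerm Z n := by
  have h : ((n : ℂ) + 1) ≠ 0 := by exact_mod_cast n.succ_ne_zero
  rw [gaussianTerm, gaussianTerm, smul_smul, mul_smul_comm, ← pow_succ', Nat.factorial_succ]
  congr 1
  push_cast
  rw [mul_inv, ← mul_assoc, mul_inv_cancel₀ h, one_mul]

theorem annih_quadratic {Z : V →L⋆[ℂ] V} (hZ : IsSymmetric Z) (x : V) :
    annih x (coord V (quadratic Z)) = coord V (SymmetricAlgebra.ι ℂ V (Z x)) := by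
  have h1 : ∑ k, ⟪x, Z (stdOrthonormalBasis ℂ V k)⟫_ℂ •
      SymmetricAlgebra.ι ℂ V (stdOrthonormalBasis ℂ V k) = SymmetricAlgebra.ι ℂ V (Z x) := by
    conv_rhs => rw [← (stdOrthonormalBasis ℂ V).sum_repr' (Z x)]
    simp only [map_sum, map_smul]
    exact Finset.sum_congr rfl fun k _ => by rw [hZ]
  have h2 : ∑ k, ⟪x, stdOrthonormalBasis ℂ V k⟫_ℂ •
      SymmetricAlgebra.ι ℂ V (Z (stdOrthonormalBasis ℂ V k)) = SymmetricAlgebra.ι ℂ V (Z x) := by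
    conv_rhs => rw [← (stdOrthonormalBasis ℂ V).sum_repr' x]
    simp only [map_sum, map_smulₛₗ, inner_conj_symm, RingHom.id_apply]
  have h3 : ∀ k, annih x (coord V (SymmetricAlgebra.ι ℂ V (stdOrthonormalBasis ℂ V k) *
      SymmetricAlgebra.ι ℂ V (Z (stdOrthonormalBasis ℂ V k)))) =
      coord V (⟪x, Z (stdOrthonormalBasis ℂ V k)⟫_ℂ •
        SymmetricAlgebra.ι ℂ V (stdOrthonormalBasis ℂ V k) +
      ⟪x, stdOrthonormalBasis ℂ V k⟫_ℂ •
        SymmetricAlgebra.ι ℂ V (Z (stdOrthonormalBasis ℂ V k))) := by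
    intro k
    rw [map_mul, Derivation.leibniz, annih_ι, annih_ι, map_add, map_smul, map_smul, smul_eq_mul,
      smul_eq_mul, Algebra.smul_def, Algebra.smul_def]
    ring
  rw [quadratic, map_smul, Derivation.map_smul, map_sum, map_sum, Finset.sum_congr rfl fun k _ => h3 k,
    ← map_sum, Finset.sum_add_distrib, h1, h2, ← two_smul ℂ, map_smul, smul_smul]
  norm_num

theorem annih_gaussianTerm_zero (Z : V →L⋆[ℂ] V) (x : V) :
    annih x (coord V (gaussianTerm Z 0)) = 0 := by
  rw [gaussianTerm_zero, map_one, Derivation.map_one_eq_zero]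

theorem annih_gaussianTerm_succ {Z : V →L⋆[ℂ] V} (hZ : IsSymmetric Z) (x : V) (n : ℕ) :
    annih x (coord V (gaussianTerm Z (n + 1))) =
      coord V (SymmetricAlgebra.ι ℂ V (Z x) * gaussianTerm Z n) := by
  have h : ((n : ℂ) + 1) ≠ 0 := by exact_mod_cast n.succ_ne_zero
  rw [gaussianTerm, gaussianTerm, map_smul, Derivation.map_smul, map_pow, Derivation.leibniz_pow,
    annih_quadratic hZ, Nat.add_sub_cancel, map_mul, map_smul, map_pow, ← Nat.cast_smul_eq_nsmul ℂ,
    smul_smul, Nat.factorial_succ, mul_smul_comm, smul_eq_mul, mul_comm (coord V _)]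
  congr 1
  push_cast
  rw [mul_inv, mul_comm, ← mul_assoc, mul_inv_cancel₀ h, one_mul]

/-- Multiplication by a vector and annihilation are adjoint. -/
theorem symInner_mul_ι (x : V) (φ ψ χ : SymmetricAlgebra ℂ V)
    (h : annih x (coord V φ) = coord V χ) :
    symInner V φ (SymmetricAlgebra.ι ℂ V x * ψ) = symInner V χ ψ := by
  rw [← symInner_conj_symm, symInner_ι_mul, h, ← symInner_apply, symInner_conj_symm]

theorem IsSymmetric.inner_apply_comm {X : V →L⋆[ℂ] V} (hX : IsSymmetric X) (v w : V) :
    ⟪X w, v⟫_ℂ = ⟪X v, w⟫_ℂ := by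
  rw [← inner_conj_symm, hX, inner_conj_symm]

theorem symInner_gaussianTerm_succ_mul_mul {X Y : V →L⋆[ℂ] V} (hX : IsSymmetric X)
    (v w : V) (n : ℕ) :
    symInner V (gaussianTerm X (n + 1))
      (SymmetricAlgebra.ι ℂ V v * (SymmetricAlgebra.ι ℂ V w * gaussianTerm Y n)) =
    ⟪X w, v⟫_ℂ * symInner V (gaussianTerm X n) (gaussianTerm Y n) +
      polyInner _ (coord V (gaussianTerm X n))
        (coord V (SymmetricAlgebra.ι ℂ V v) * annih (X w) (coord V (gaussianTerm Y n))) := by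
  rw [mul_left_comm, symInner_mul_ι w _ _ _ (annih_gaussianTerm_succ hX w n), symInner_ι_mul,
    map_mul, Derivation.leibniz, annih_ι, add_comm, map_add, smul_eq_mul, smul_eq_mul,
    mul_comm (coord V (gaussianTerm Y n)), ← Algebra.smul_def, map_smul, smul_eq_mul,
    ← symInner_apply]

/-- The pairing of `e^X` with the product of two vectors and `e^Y`, degree by degree. -/
theorem symInner_gaussianTerm_succ_eq_sum {X Y : V →L⋆[ℂ] V} (hX : IsSymmetric X)
    (hY : IsSymmetric Y) (v : V) (n : ℕ) : ∀ w : V,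
    symInner V (gaussianTerm X (n + 1))
      (SymmetricAlgebra.ι ℂ V v * (SymmetricAlgebra.ι ℂ V w * gaussianTerm Y n)) =
    ∑ j ∈ Finset.range (n + 1), ⟪X (((Y.comp X : V →L[ℂ] V) ^ j) w), v⟫_ℂ *
      symInner V (gaussianTerm X (n - j)) (gaussianTerm Y (n - j)) := by
  induction n with
  | zero =>
    intro w
    rw [symInner_gaussianTerm_succ_mul_mul hX, annih_gaussianTerm_zero]
    simp
  | succ n ih =>
    intro w
    rw [symInner_gaussianTerm_succ_mul_mul hX, annih_gaussianTerm_succ hY, ← map_mul,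
      ← symInner_apply, ih, Finset.sum_range_succ' _ (n + 1), add_comm]
    simp [pow_succ]

theorem inner_pow_comp_comm {X Y : V →L⋆[ℂ] V} (hX : IsSymmetric X) (hY : IsSymmetric Y)
    (j : ℕ) : ∀ x y : V, ⟪x, ((Y.comp X : V →L[ℂ] V) ^ j) (Y y)⟫_ℂ =
      ⟪y, ((Y.comp X : V →L[ℂ] V) ^ j) (Y x)⟫_ℂ := by
  induction j with
  | zero => exact fun x y => by simpa using hY y x
  | succ j ih =>
    intro x y
    have h1 : ((Y.comp X : V →L[ℂ] V) ^ (j + 1)) (Y y) =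
        ((Y.comp X : V →L[ℂ] V) ^ j) (Y (X (Y y))) := by simp [pow_succ]
    have h2 : ((Y.comp X : V →L[ℂ] V) ^ (j + 1)) (Y x) =
        Y (X (((Y.comp X : V →L[ℂ] V) ^ j) (Y x))) := by simp [pow_succ']
    rw [h1, h2, ih, hX.inner_apply_comm, hY]

theorem sum_inner_comp_pow {X Y : V →L⋆[ℂ] V} (hX : IsSymmetric X) (hY : IsSymmetric Y)
    (j : ℕ) : ∑ k, ⟪X (((Y.comp X : V →L[ℂ] V) ^ j) (Y (stdOrthonormalBasis ℂ V k))),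
      stdOrthonormalBasis ℂ V k⟫_ℂ =
    LinearMap.trace ℂ V ((Y.comp X : V →L[ℂ] V) ^ (j + 1) : V →L[ℂ] V) := by
  rw [LinearMap.trace_eq_sum_inner _ (stdOrthonormalBasis ℂ V)]
  refine Finset.sum_congr rfl fun k _ => ?_
  rw [hX.inner_apply_comm, inner_pow_comp_comm hX hY, pow_succ]
  rfl

/-- The recursion that the coefficients of `⟨e^X : e^Y⟩` satisfy. -/
theorem symInner_gaussianTerm_recursion {X Y : V →L⋆[ℂ] V} (hX : IsSymmetric X)
    (hY : IsSymmetric Y) (n : ℕ) :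
    ((n : ℂ) + 1) * symInner V (gaussianTerm X (n + 1)) (gaussianTerm Y (n + 1)) =
    (1 / 2 : ℂ) * ∑ j ∈ Finset.range (n + 1),
      LinearMap.trace ℂ V ((Y.comp X : V →L[ℂ] V) ^ (j + 1) : V →L[ℂ] V) *
        symInner V (gaussianTerm X (n - j)) (gaussianTerm Y (n - j)) := by
  rw [← smul_eq_mul ((n : ℂ) + 1), ← map_smul, succ_smul_gaussianTerm_succ, quadratic,
    smul_mul_assoc, map_smul, smul_eq_mul, Finset.sum_mul, map_sum]
  congr 1
  simp only [mul_assoc, symInner_gaussianTerm_succ_eq_sum hX hY]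
  rw [Finset.sum_comm]
  refine Finset.sum_congr rfl fun j _ => ?_
  rw [← Finset.sum_mul, sum_inner_comp_pow hX hY]

theorem gaussian_apply_of_mem (Z : V →L⋆[ℂ] V) {d : ℕ} {θ : SymmetricAlgebra ℂ V}
    (hθ : θ ∈ symPow V d) {ψ : SymmetricAlgebra ℂ V}
    (h : ∀ n, 2 * n = d → ψ = gaussianTerm Z n) (h0 : (∀ n, 2 * n ≠ d) → ψ = 0) :
    gaussian Z θ = symInner V θ ψ := by
  change ∑ᶠ n : ℕ, symInner V θ (gaussianTerm Z n) = _
  by_cases hd : ∃ n, 2 * n = d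
  · obtain ⟨n, hn⟩ := hd
    rw [finsum_eq_single _ n, h n hn]
    intro k hk
    exact symInner_of_mem_symPow (by omega) hθ (gaussianTerm_mem Z k)
  · push Not at hd
    rw [h0 hd, map_zero]
    refine finsum_eq_zero_of_forall_eq_zero fun k => ?_
    exact symInner_of_mem_symPow (hd k).symm hθ (gaussianTerm_mem Z k)

theorem component_eq_of_forall {Φ : Antidual V} {d : ℕ} {ψ : SymmetricAlgebra ℂ V}
    (hψ : ψ ∈ symPow V d) (h : ∀ θ ∈ symPow V d, Φ θ = symInner V θ ψ) :
    component Φ d = ψ := by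
  by_contra hne
  have hmem : component Φ d - ψ ∈ symPow V d := Submodule.sub_mem _ (component_mem Φ d) hψ
  have := symInner_self_pos (sub_ne_zero.2 hne)
  rw [map_sub, ← component_spec Φ hmem, h _ hmem, sub_self] at this
  simp at this

theorem component_gaussian_even (Z : V →L⋆[ℂ] V) (n : ℕ) :
    component (gaussian Z) (2 * n) = gaussianTerm Z n :=
  component_eq_of_forall (gaussianTerm_mem Z n) fun θ hθ =>
    gaussian_apply_of_mem Z hθ (fun k hk => by rw [show k = n by omega])
      fun h => absurd rfl (h n)

theorem component_gaussian_of_odd (Z : V →L⋆[ℂ] V) {d : ℕ} (hd : ∀ n, 2 * n ≠ d) :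
    component (gaussian Z) d = 0 :=
  component_eq_of_forall (Submodule.zero_mem _) fun _ hθ =>
    gaussian_apply_of_mem Z hθ (fun k hk => absurd hk (hd k)) fun _ => rfl

theorem hasPairingAt_gaussian {X Y : V →L⋆[ℂ] V} {t : ℝ} {c : ℂ}
    (h : HasSum (fun n : ℕ => symInner V (gaussianTerm X n) (gaussianTerm Y n) *
      ((t : ℂ) ^ 4) ^ n) c) : HasPairingAt t (gaussian X) (gaussian Y) c := by
  refine HasSum.tendsto_sum_nat (f := fun d => symInner V (component (gaussian X) d)
    (component (gaussian Y) d) * (t : ℂ) ^ (2 * d)) ?_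
  rw [← Function.Injective.hasSum_iff (g := fun n : ℕ => 2 * n) (fun a b h => by simpa using h)]
  · refine h.congr_fun fun n => ?_
    simp only [Function.comp_apply, component_gaussian_even, ← pow_mul, ← mul_assoc]
    norm_num
  · intro d hd
    rw [component_gaussian_of_odd X fun n hn => hd ⟨n, hn⟩]
    simp

end GaussianRecursion

end BosonicPairing

namespace BosonicPairing

noncomputable section DeterminantExpansion

variable {V : Type*} [NormedAddCommGroup V] [InnerProductSpace ℂ V]

theorem norm_apply_le_of_norm_le_one {T : V →L[ℂ] V} (hT : ‖T‖ ≤ 1) (v : V) : ‖T v‖ ≤ ‖v‖ :=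
  (T.le_of_opNorm_le hT v).trans_eq (one_mul _)

theorem re_inner_one_sub (T : V →L[ℂ] V) (v : V) :
    (⟪v, (1 - T) v⟫_ℂ).re = ‖v‖ ^ 2 - (⟪v, T v⟫_ℂ).re := by
  have h : (((‖v‖ : ℂ) ^ 2)).re = ‖v‖ ^ 2 := by norm_cast
  rw [sub_apply, inner_sub_right, Complex.sub_re, ← h,
    one_apply_eq_self, inner_self_eq_norm_sq_to_K (𝕜 := ℂ) v]
  rfl

/-- If `I - T` is invertible with `‖T‖ ≤ 1` then it has positive real part. -/
theorem one_sub_mem_posRe {T : V →L[ℂ] V} (hT : ‖T‖ ≤ 1) (h : IsUnit (1 - T)) :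
    1 - T ∈ posRe V := by
  intro v hv
  rw [re_inner_one_sub]
  have hne : (1 - T) v ≠ 0 := by
    obtain ⟨u, hu⟩ := h
    intro h0
    apply hv
    have : (↑u⁻¹ * ↑u : V →L[ℂ] V) v = 0 := by
      rw [mul_apply_eq_comp, hu, h0, map_zero]
    simpa using this
  have h1 : 0 < ‖v - T v‖ := norm_pos_iff.2 (by simpa using hne)
  have h2 := norm_sub_sq (𝕜 := ℂ) v (T v)
  have h3 := norm_apply_le_of_norm_le_one hT v
  have h4 : ‖T v‖ ^ 2 ≤ ‖v‖ ^ 2 := by gcongr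
  have h5 : 0 < ‖v - T v‖ ^ 2 := by positivity
  have h6 : RCLike.re ⟪v, T v⟫_ℂ = (⟪v, T v⟫_ℂ).re := rfl
  linarith

theorem one_sub_smul_mem_posRe {T : V →L[ℂ] V} (hT : ‖T‖ ≤ 1) {z : ℂ} (hz : ‖z‖ < 1) :
    1 - z • T ∈ posRe V := by
  intro v hv
  rw [re_inner_one_sub]
  have hv' : 0 < ‖v‖ := norm_pos_iff.2 hv
  have h1 : (⟪v, (z • T) v⟫_ℂ).re ≤ ‖v‖ * ‖(z • T) v‖ :=
    (Complex.re_le_norm _).trans (norm_inner_le_norm _ _)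
  have h2 : ‖(z • T) v‖ ≤ ‖z‖ * ‖v‖ := by
    rw [smul_apply, norm_smul]
    exact mul_le_mul_of_nonneg_left (norm_apply_le_of_norm_le_one hT v) (norm_nonneg z)
  have h3 : ‖v‖ * ‖(z • T) v‖ ≤ ‖v‖ * (‖z‖ * ‖v‖) := by gcongr
  have h4 : ‖z‖ * ‖v‖ ^ 2 < 1 * ‖v‖ ^ 2 := by gcongr
  nlinarith

variable [FiniteDimensional ℂ V]

theorem hasDerivAt_det_one_add_smul (M : V →L[ℂ] V) :
    HasDerivAt (fun w : ℂ => (1 + w • M : V →L[ℂ] V).det) (LinearMap.trace ℂ V M) 0 := by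
  let b := Module.finBasis ℂ V
  let A := LinearMap.toMatrix b b (M : V →ₗ[ℂ] V)
  let q := (Matrix.det (1 + (Polynomial.X : Polynomial ℂ) • A.map Polynomial.C)).divX.divX
  have h : (fun w : ℂ => (1 + w • M : V →L[ℂ] V).det) =
      fun w => 1 + LinearMap.trace ℂ V M * w + q.eval w * w ^ 2 := by
    funext w
    rw [ContinuousLinearMap.det, ← LinearMap.det_toMatrix b, LinearMap.trace_eq_matrix_trace ℂ b,
      ← Matrix.det_one_add_smul]
    congr 1
    simp [LinearMap.toMatrix_one, ContinuousLinearMap.toLinearMap_add]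
  rw [h]
  have := (((hasDerivAt_id (0 : ℂ)).const_mul (LinearMap.trace ℂ V M)).const_add 1).add
    ((q.hasDerivAt 0).mul ((hasDerivAt_id (0 : ℂ)).pow 2))
  convert! this using 1
  simp

theorem hasDerivAt_det_one_sub_smul (T : V →L[ℂ] V) {z : ℂ} (hz : IsUnit (1 - z • T)) :
    HasDerivAt (fun w : ℂ => (1 - w • T : V →L[ℂ] V).det)
      (-((1 - z • T).det * LinearMap.trace ℂ V (T * Ring.inverse (1 - z • T) : V →L[ℂ] V))) z := by
  let M : V →L[ℂ] V := -(T * Ring.inverse (1 - z • T))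
  have h : (fun w : ℂ => (1 - w • T : V →L[ℂ] V).det) =
      fun w => (1 + (w - z) • M : V →L[ℂ] V).det * (1 - z • T).det := by
    funext w
    have : (1 - w • T : V →L[ℂ] V) = (1 + (w - z) • M) * (1 - z • T) := by
      rw [add_mul, smul_mul_assoc, neg_mul, mul_assoc, Ring.inverse_mul_cancel _ hz, mul_one,
        one_mul, sub_smul, smul_neg, smul_neg]
      abel
    rw [this]
    exact LinearMap.det_comp _ _
  rw [h]
  have h0 := hasDerivAt_det_one_add_smul M
  have h1 : HasDerivAt (fun w : ℂ => (1 + (w - z) • M : V →L[ℂ] V).det)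
      (LinearMap.trace ℂ V M) z := by
    have := HasDerivAt.comp_sub_const z z (by rw [sub_self]; exact h0)
    exact this
  convert! h1.mul_const _ using 1
  simp only [M, ContinuousLinearMap.toLinearMap_neg, map_neg]
  ring

variable (V) in
/-- The trace as a continuous functional. -/
def traceCLM : (V →L[ℂ] V) →L[ℂ] ℂ :=
  LinearMap.toContinuousLinearMap (LinearMap.trace ℂ V ∘ₗ ContinuousLinearMap.coeLM ℂ)

theorem traceCLM_apply (T : V →L[ℂ] V) : traceCLM V T = LinearMap.trace ℂ V T := rfl

/-- The resolvent trace `tr (T (I - zT)⁻¹)`. -/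
def resolventTrace (T : V →L[ℂ] V) (z : ℂ) : ℂ :=
  traceCLM V (T * Ring.inverse (1 - z • T))

theorem hasFPowerSeriesOnBall_resolventTrace (T : V →L[ℂ] V) :
    HasFPowerSeriesOnBall (resolventTrace T)
      (((traceCLM V).comp (ContinuousLinearMap.mul ℂ (V →L[ℂ] V) T)).compFormalMultilinearSeries
        fun n => ContinuousMultilinearMap.mkPiRing ℂ (Fin n) (T ^ n)) 0 (↑‖T‖₊)⁻¹ := by
  have := FiniteDimensional.complete ℂ V
  exact ((traceCLM V).comp (ContinuousLinearMap.mul ℂ (V →L[ℂ] V) T)).comp_hasFPowerSeriesOnBall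
    (spectrum.hasFPowerSeriesOnBall_inverse_one_sub_smul ℂ T)

theorem iteratedDeriv_resolventTrace (T : V →L[ℂ] V) (n : ℕ) :
    iteratedDeriv n (resolventTrace T) 0 =
      n.factorial * LinearMap.trace ℂ V (T ^ (n + 1) : V →L[ℂ] V) := by
  rw [iteratedDeriv, ← (hasFPowerSeriesOnBall_resolventTrace T).factorial_smul 1 n]
  rw [nsmul_eq_mul, pow_succ', ← traceCLM_apply]
  congr 1
  change traceCLM V (T * ContinuousMultilinearMap.mkPiRing ℂ (Fin n) (T ^ n) fun _ => 1) = _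
  rw [ContinuousMultilinearMap.mkPiRing_apply, Finset.prod_const_one, one_smul]

theorem detSqrt_ne_zero {T : V →L[ℂ] V} (hT : T ∈ posRe V) : detSqrt V T ≠ 0 := by
  intro h
  have := isDetSqrt_detSqrt.sq_eq T hT
  rw [h] at this
  exact det_ne_zero_of_mem_posRe hT (by simpa using this.symm)

theorem isUnit_of_mem_posRe {T : V →L[ℂ] V} (hT : T ∈ posRe V) : IsUnit T := by
  have := FiniteDimensional.complete ℂ V
  exact ContinuousLinearMap.isUnit_iff_isUnit_toLinearMap.2
    ((T : V →ₗ[ℂ] V).isUnit_iff_isUnit_det.2 (isUnit_iff_ne_zero.2 (det_ne_zero_of_mem_posRe hT)))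

/-- The function `z ↦ Det^{1/2}(I - zT)⁻¹`. -/
def invDetSqrt (T : V →L[ℂ] V) (z : ℂ) : ℂ := (detSqrt V (1 - z • T))⁻¹

theorem hasDerivAt_invDetSqrt {T : V →L[ℂ] V} {z : ℂ} (hz : 1 - z • T ∈ posRe V) :
    HasDerivAt (invDetSqrt T) ((1 / 2) * (resolventTrace T z * invDetSqrt T z)) z := by
  have hr0 := detSqrt_ne_zero hz
  have hd : DifferentiableAt ℂ (fun w : ℂ => detSqrt V (1 - w • T)) z := by
    refine DifferentiableAt.comp (g := detSqrt V) z (isDetSqrt_detSqrt.differentiableOn.differentiableAt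
      (isOpen_posRe.mem_nhds hz)) ?_
    fun_prop
  obtain ⟨r', hr'⟩ : ∃ r', HasDerivAt (fun w : ℂ => detSqrt V (1 - w • T)) r' z := ⟨_, hd.hasDerivAt⟩
  have hev : (fun w : ℂ => (1 - w • T : V →L[ℂ] V).det) =ᶠ[𝓝 z]
      fun w => detSqrt V (1 - w • T) ^ 2 := by
    have hc : ContinuousAt (fun w : ℂ => (1 - w • T : V →L[ℂ] V)) z := by fun_prop
    filter_upwards [hc.eventually (isOpen_posRe.mem_nhds hz)] with w hw
    exact (isDetSqrt_detSqrt.sq_eq _ hw).symm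
  have h1 := (hr'.pow 2).unique
    ((hasDerivAt_det_one_sub_smul T (isUnit_of_mem_posRe hz)).congr_of_eventuallyEq hev.symm)
  have h2 := hr'.inv hr0
  refine h2.congr_deriv ?_
  rw [← isDetSqrt_detSqrt.sq_eq _ hz] at h1
  change _ = 1 / 2 * (LinearMap.trace ℂ V (T * Ring.inverse (1 - z • T) : V →L[ℂ] V) *
    (detSqrt V (1 - z • T))⁻¹)
  set r := detSqrt V (1 - z • T)
  set τ := LinearMap.trace ℂ V (T * Ring.inverse (1 - z • T) : V →L[ℂ] V)
  have h3 : r' = -(1 / 2) * (r * τ) := by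
    apply mul_left_cancel₀ hr0
    push_cast at h1
    linear_combination (1 / 2) * h1
  rw [h3]
  field_simp

theorem differentiableOn_invDetSqrt {T : V →L[ℂ] V} (hT : ‖T‖ ≤ 1) :
    DifferentiableOn ℂ (invDetSqrt T) (Metric.ball 0 1) := fun z hz =>
  (hasDerivAt_invDetSqrt (one_sub_smul_mem_posRe hT (by simpa using hz))).differentiableAt.differentiableWithinAt

/-- The recursion for the derivatives of `Det^{1/2}(I - zT)⁻¹` at `0`. -/
theorem iteratedDeriv_invDetSqrt_succ {T : V →L[ℂ] V} (hT : ‖T‖ ≤ 1) (n : ℕ) :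
    iteratedDeriv (n + 1) (invDetSqrt T) 0 = (1 / 2) * ∑ j ∈ Finset.range (n + 1),
      n.choose j * (j.factorial * LinearMap.trace ℂ V (T ^ (j + 1) : V →L[ℂ] V)) *
        iteratedDeriv (n - j) (invDetSqrt T) 0 := by
  have hev : deriv (invDetSqrt T) =ᶠ[𝓝 0]
      fun z => (1 / 2) * (resolventTrace T z * invDetSqrt T z) := by
    filter_upwards [Metric.ball_mem_nhds (0 : ℂ) one_pos] with z hz
    exact (hasDerivAt_invDetSqrt (one_sub_smul_mem_posRe hT (by simpa using hz))).deriv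
  have hg : ContDiffAt ℂ n (resolventTrace T) 0 :=
    (hasFPowerSeriesOnBall_resolventTrace T).analyticAt.contDiffAt
  have hh : ContDiffAt ℂ n (invDetSqrt T) 0 :=
    ((differentiableOn_invDetSqrt hT).analyticAt (Metric.ball_mem_nhds 0 one_pos)).contDiffAt
  rw [iteratedDeriv_succ', hev.iteratedDeriv_eq, iteratedDeriv_const_mul_field,
    iteratedDeriv_fun_mul hg hh]
  simp only [iteratedDeriv_resolventTrace]

/-- A sequence that satisfies the recursion of the Taylor coefficients of
`Det^{1/2}(I - zT)⁻¹` sums to this function on the unit disc. -/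
theorem hasSum_invDetSqrt_of_recursion {T : V →L[ℂ] V} (hT : ‖T‖ ≤ 1) {a : ℕ → ℂ} (h0 : a 0 = 1)
    (ha : ∀ n : ℕ, ((n : ℂ) + 1) * a (n + 1) = (1 / 2 : ℂ) * ∑ j ∈ Finset.range (n + 1),
      LinearMap.trace ℂ V (T ^ (j + 1) : V →L[ℂ] V) * a (n - j)) {z : ℂ} (hz : ‖z‖ < 1) :
    HasSum (fun n => a n * z ^ n) (invDetSqrt T z) := by
  have key : ∀ n, iteratedDeriv n (invDetSqrt T) 0 = n.factorial * a n := by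
    intro n
    induction n using Nat.strong_induction_on with
    | _ n ih =>
      cases n with
      | zero => simp [invDetSqrt, isDetSqrt_detSqrt.map_one, h0]
      | succ n =>
        have : (((n + 1).factorial : ℕ) : ℂ) * a (n + 1) =
            n.factorial * (((n : ℂ) + 1) * a (n + 1)) := by
          rw [Nat.factorial_succ]
          push_cast
          ring
        rw [this, ha, iteratedDeriv_invDetSqrt_succ hT, mul_left_comm,
          Finset.mul_sum (Finset.range (n + 1)) _ (n.factorial : ℂ)]
        congr 1
        refine Finset.sum_congr rfl fun j hj => ?_
        have hj : j ≤ n := Nat.lt_succ_iff.1 (Finset.mem_range.1 hj)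
        rw [ih (n - j) (by omega), ← Nat.choose_mul_factorial_mul_factorial hj]
        push_cast
        ring
  have := Complex.hasSum_taylorSeries_on_ball (f := invDetSqrt T) (c := 0) (r := 1)
    (differentiableOn_invDetSqrt hT) (z := z) (by simpa using hz)
  refine this.congr_fun fun n => ?_
  rw [key, sub_zero, smul_eq_mul, smul_eq_mul]
  have : (n.factorial : ℂ) ≠ 0 := Nat.cast_ne_zero.2 n.factorial_ne_zero
  field_simp

end DeterminantExpansion

end BosonicPairing

theorem theorem8 {V : Type*} [NormedAddCommGroup V] [InnerProductSpace ℂ V]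
    [FiniteDimensional ℂ V] (X Y : V →L⋆[ℂ] V)
    (hX : X ∈ BosonicPairing.closedSiegel V) (hY : Y ∈ BosonicPairing.closedSiegel V)
    (hXY : IsUnit (1 - Y.comp X : V →L[ℂ] V)) :
    (1 - Y.comp X : V →L[ℂ] V) ∈ BosonicPairing.posRe V ∧
      BosonicPairing.HasPairing (BosonicPairing.gaussian X) (BosonicPairing.gaussian Y)
        (BosonicPairing.detSqrt V (1 - Y.comp X))⁻¹ := by
  open BosonicPairing in
  have hT : ‖(Y.comp X : V →L[ℂ] V)‖ ≤ 1 :=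
    (Y.opNorm_comp_le X).trans (mul_le_one₀ hY.2 (norm_nonneg X) hX.2)
  have hpos := one_sub_mem_posRe hT hXY
  refine ⟨hpos, fun t => invDetSqrt (Y.comp X) ((t : ℂ) ^ 4), fun t ht => ?_, ?_⟩
  · refine hasPairingAt_gaussian (hasSum_invDetSqrt_of_recursion
      (a := fun n => symInner V (gaussianTerm X n) (gaussianTerm Y n)) hT ?_
      (symInner_gaussianTerm_recursion hX.1 hY.1) ?_)
    · rw [gaussianTerm_zero, gaussianTerm_zero, symInner_one]
    · rw [norm_pow, Complex.norm_real, Real.norm_of_nonneg ht.1.le]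
      exact pow_lt_one₀ ht.1.le ht.2 (by norm_num)
  · have hz : 1 - (1 : ℂ) • (Y.comp X : V →L[ℂ] V) ∈ posRe V := by rwa [one_smul]
    have hc : ContinuousAt (fun t : ℝ => invDetSqrt (Y.comp X) ((t : ℂ) ^ 4)) 1 := by
      refine ContinuousAt.comp (g := invDetSqrt (Y.comp X)) ?_ (by fun_prop)
      simpa using (hasDerivAt_invDetSqrt hz).continuousAt
    have := hc.tendsto.mono_left (nhdsWithin_le_nhds (s := Set.Iio 1))
    simpa [invDetSqrt] using this
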